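/- All graphs are finite and simple. In the domination game on a graph $G$, Dominator and Staller alternately choose vertices; a vertex may be chosen only if its closed neighbourhood contains at least one vertex not yet dominated, i.e. not in the closed neighbourhood of a previously chosen vertex. The game ends when all vertices are dominated. Dominator wants the total number of moves to be as small as possible, Staller as large as possible. Let $\gamma_g'(G)$ be the number of moves when both play optimally and Staller has the first move. For $k\ge 0$ let $Y_k$ be the following graph. Take a 5-cycle, a vertex $t$ of it and the two neighbours $x,x'$ of $t$ on it; add a new vertex $y$ adjacent to $x$ and $x'$; attach two leaves to $x$ and one leaf to $t$; finally, attach $k$ paths on three vertices by identifying one end vertex of each of them with $x$. Let $H$ be the graph obtained from the disjoint union of a star $K_{1,4}$ and a triangle by joining the center of the star with one vertex of the triangle and adding an edge $e_H$ between another vertex of the triangle and a leaf of the star. Then: (1) For every integer $\ell\ge 4$ there is a connected graph $G$ with an edge $e$ such that $\gamma_g'(G)=\ell$ and $\gamma_g'(G-e)=\ell-1$. (2) For every $k\ge 0$ the graph $Y_k$ is connected, and with $e=x'y$ we have $\gamma_g'(Y_k)=k+5$ and $\gamma_g'(Y_k-e)=k+4$. (3) The graph $H$ is connected, $\gamma_g'(H)=4$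 and $\gamma_g'(H-e_H)=3$. (4) For every integer $0\le \ell<4$ there is no graph $G$ (connected or not) with an edge $e$ such that $\gamma_g'(G)=\ell$ and $\gamma_g'(G-e)=\ell-1$. -/

import Mathlib

namespace DominationGame

/-- The two players of the domination game. -/
inductive Player where
  | dominator
  | staller

section Game

variable {V : Type*} [Fintype V] (G : SimpleGraph V)

open Classical in
/-- The closed neighbourhood `N[v]`, i.e. the set of vertices dominated by `v`. -/
noncomputable def closedNbhd (v : V) : Finset V :=
  Finset.univ.filter (fun w => w = v ∨ G.Adj v w)

open Classical in
/-- When `D` is the set of dominated vertices, a vertex may be chosen if and only if it dominates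
at least one vertex outside `D`. -/
noncomputable def legalMoves (D : Finset V) : Finset V :=
  Finset.univ.filter (fun v => ¬ closedNbhd G v ⊆ D)

open Classical in
/-- The set of dominated vertices after `v` has been chosen. -/
noncomputable def play (D : Finset V) (v : V) : Finset V := D ∪ closedNbhd G v

theorem card_compl_play_lt {D : Finset V} {v : V} (hv : v ∈ legalMoves G D) :
    Fintype.card V - (play G D v).card < Fintype.card V - D.card := by
  classical
  have h : ¬ closedNbhd G v ⊆ D := by simpa [legalMoves] using hv
  have hlt : D.card < (play G D v).card := by
    apply Finset.card_lt_card
    refine ⟨fun x hx => ?_, fun hs => h fun x hx => hs ?_⟩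
    · simp [play, hx]
    · simp [play, hx]
  have hle : (play G D v).card ≤ Fintype.card V := Finset.card_le_univ _
  omega

/-- The number of moves made, under optimal play, in the rest of the game on `G` when the vertices
of `D` are already dominated and the given player moves next. The game ends when there is no legal
move (equivalently, when all vertices are dominated); Dominator minimizes and Staller maximizes
the number of moves. -/
noncomputable def movesLeft : Player → Finset V → ℕ
  | Player.dominator, D =>
      if h : (legalMoves G D).Nonempty then
        1 + (legalMoves G D).attach.inf' (Finset.attach_nonempty_iff.mpr h)
          (fun v => movesLeft Player.staller (play G D v.1))
      else 0
  | Player.staller, D =>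
      if h : (legalMoves G D).Nonempty then
        1 + (legalMoves G D).attach.sup' (Finset.attach_nonempty_iff.mpr h)
          (fun v => movesLeft Player.dominator (play G D v.1))
      else 0
termination_by _ D => Fintype.card V - D.card
decreasing_by all_goals exact card_compl_play_lt G v.2

/-- The Staller-start game domination number `γ_g'(G)`: the number of moves in the game in which
Staller has the first move and no vertex is dominated at the start. -/
noncomputable def stallerGameDominationNumber : ℕ := movesLeft G Player.staller ∅

end Game

/-- The vertex set of `Y_k`: the nine vertices of `Y_0` and two new vertices for each of the `k`
attached paths on three vertices. In `Y_0`, the vertices are `0 = x`, `1 = t`, `2 = x'`,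
`3` and `4` (these five form the 5-cycle), `5 = y`, the leaves `6`, `7` at `x`, and the leaf `8`
at `t`. -/
abbrev YVertex (k : ℕ) : Type := Fin 9 ⊕ (Fin k × Fin 2)

/-- The edges of `Y_0`: the 5-cycle `x t x' 3 4`, the two edges from `y` to `x` and `x'`, and the
three pendant edges. -/
def edgesY0 : Set (Sym2 (Fin 9)) :=
  {s(0, 1), s(1, 2), s(2, 3), s(3, 4), s(4, 0), s(5, 0), s(5, 2), s(6, 0), s(7, 0), s(8, 1)}

/-- The graph `Y_k`: `Y_0` with `k` paths on three vertices, an end vertex of each of which is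
identified with `x`. -/
def graphY (k : ℕ) : SimpleGraph (YVertex k) :=
  SimpleGraph.fromEdgeSet
    (Sym2.map Sum.inl '' edgesY0
      ∪ Set.range (fun i : Fin k => s(Sum.inl 0, Sum.inr (i, 0)))
      ∪ Set.range (fun i : Fin k => s(Sum.inr (i, 0), Sum.inr (i, 1))))

/-- The edge `e = x'y` of `Y_k`. -/
def edgeY (k : ℕ) : Sym2 (YVertex k) := s(Sum.inl 2, Sum.inl 5)

/-- The graph `H`: the star `K_{1,4}` with center `0` and leaves `1, 2, 3, 4`, the triangle
`5 6 7`, the edge joining the center `0` to `5`, and the edge joining `6` to the leaf `1`. -/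
def graphH : SimpleGraph (Fin 8) :=
  SimpleGraph.fromEdgeSet
    {s(0, 1), s(0, 2), s(0, 3), s(0, 4), s(5, 6), s(6, 7), s(5, 7), s(0, 5), s(6, 1)}

/-- The edge `e` of `H` between the triangle and a leaf of the star. -/
def edgeH : Sym2 (Fin 8) := s(6, 1)

end DominationGame

/-! Deleting `e` leaves its two ends nonadjacent, so the value after deletion is at least 2, and a
drop by one needs `ℓ ≥ 3`. If the smaller value is 2, Dominator finishes in one move after any first
move of Staller; the same reply still works when `e` is restored, so `ℓ = 3` is impossible.

For the examples, Dominator's upper bound comes from answering the first move at the hub (`x`, or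
the center of the star): few vertices then remain, and each move dominates at least one of them.
Without `e` one further move is saved, because Staller loses the move that dominates one end of `e`
without dominating any other remaining vertex. The lower bounds come from `le_movesLeft_of_forces`:
Staller plays in a small core, where her strategy survives passes by Dominator and is checked by
computation, while each attached path needs a move of its own for its far end. -/

namespace DominationGame

/-! ### Recursion rules and general bounds for the length of the game. -/

section Game

variable {V : Type*} [Fintype V] {G : SimpleGraph V}

theorem mem_closedNbhd {v w : V} : w ∈ closedNbhd G v ↔ w = v ∨ G.Adj v w := by
  simp [closedNbhd]

theorem self_mem_closedNbhd (v : V) : v ∈ closedNbhd G v := mem_closedNbhd.2 (Or.inl rfl)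

theorem mem_play {D : Finset V} {v w : V} : w ∈ play G D v ↔ w ∈ D ∨ w ∈ closedNbhd G v := by
  simp [play]

theorem subset_play (D : Finset V) (v : V) : D ⊆ play G D v := fun _ h => mem_play.2 (Or.inl h)

theorem closedNbhd_subset_play (D : Finset V) (v : V) : closedNbhd G v ⊆ play G D v :=
  fun _ h => mem_play.2 (Or.inr h)

theorem mem_legalMoves {D : Finset V} {v : V} :
    v ∈ legalMoves G D ↔ ∃ w ∈ closedNbhd G v, w ∉ D := by
  simp [legalMoves, Finset.not_subset]

theorem mem_legalMoves_self {D : Finset V} {v : V} (hv : v ∉ D) : v ∈ legalMoves G D :=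
  mem_legalMoves.2 ⟨v, self_mem_closedNbhd v, hv⟩

theorem movesLeft_staller_le {D : Finset V} {n : ℕ}
    (h : ∀ v ∈ legalMoves G D, movesLeft G Player.dominator (play G D v) ≤ n) :
    movesLeft G Player.staller D ≤ n + 1 := by
  rw [movesLeft]
  split_ifs with hne
  · rw [add_comm]
    exact Nat.add_le_add_right (Finset.sup'_le _ _ fun v _ => h v.1 v.2) 1
  · exact Nat.zero_le _

theorem movesLeft_dominator_le {D : Finset V} {n : ℕ} {v : V} (hv : v ∈ legalMoves G D)
    (h : movesLeft G Player.staller (play G D v) ≤ n) :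
    movesLeft G Player.dominator D ≤ n + 1 := by
  rw [movesLeft, dif_pos ⟨v, hv⟩, add_comm]
  exact Nat.add_le_add_right
    ((Finset.inf'_le _ (Finset.mem_attach _ (⟨v, hv⟩ : {x // x ∈ legalMoves G D}))).trans h) 1

theorem le_movesLeft_staller {D : Finset V} {n : ℕ} {v : V} (hv : v ∈ legalMoves G D)
    (h : n ≤ movesLeft G Player.dominator (play G D v)) :
    n + 1 ≤ movesLeft G Player.staller D := by
  rw [movesLeft, dif_pos ⟨v, hv⟩, add_comm 1]
  exact Nat.add_le_add_right (h.trans (Finset.le_sup'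
    (fun v : {x // x ∈ legalMoves G D} => movesLeft G Player.dominator (play G D v.1))
    (Finset.mem_attach _ ⟨v, hv⟩))) 1

theorem le_movesLeft_dominator {D : Finset V} {n : ℕ} (hne : (legalMoves G D).Nonempty)
    (h : ∀ v ∈ legalMoves G D, n ≤ movesLeft G Player.staller (play G D v)) :
    n + 1 ≤ movesLeft G Player.dominator D := by
  rw [movesLeft, dif_pos hne, add_comm 1]
  exact Nat.add_le_add_right (Finset.le_inf' _ _ fun v _ => h v.1 v.2) 1

theorem movesLeft_eq_zero {p : Player} {D : Finset V} (h : ∀ v, v ∈ D) :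
    movesLeft G p D = 0 := by
  have : ¬ (legalMoves G D).Nonempty := by
    rintro ⟨v, hv⟩
    obtain ⟨w, -, hw⟩ := mem_legalMoves.1 hv
    exact hw (h w)
  cases p <;> rw [movesLeft, dif_neg this]

/-- Each move dominates a new vertex. -/
theorem movesLeft_le_card {p : Player} {D U : Finset V} (hU : ∀ v, v ∉ D → v ∈ U) :
    movesLeft G p D ≤ U.card := by
  classical
  induction hn : U.card generalizing p D U with
  | zero =>
    rw [Finset.card_eq_zero] at hn
    subst hn
    rw [movesLeft_eq_zero fun v => by_contra fun hv => by simpa using hU v hv]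
  | succ n ih =>
    have key : ∀ (q : Player) (v : V), v ∈ legalMoves G D → movesLeft G q (play G D v) ≤ n := by
      intro q v hv
      obtain ⟨w, hw, hwD⟩ := mem_legalMoves.1 hv
      refine ih (U := U.erase w) (fun u hu => ?_) ?_
      · rw [mem_play, not_or] at hu
        exact Finset.mem_erase.2 ⟨fun h => hu.2 (h ▸ hw), hU u hu.1⟩
      · rw [Finset.card_erase_of_mem (hU w hwD), hn, Nat.add_sub_cancel]
    cases p with
    | staller => exact movesLeft_staller_le (key _)
    | dominator =>
      by_cases hne : (legalMoves G D).Nonempty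
      · obtain ⟨v, hv⟩ := hne
        exact movesLeft_dominator_le hv (key _ v hv)
      · rw [movesLeft, dif_neg hne]
        exact Nat.zero_le _

/-- Undominated vertices no two of which can be dominated by the same move need a move each. -/
theorem card_le_movesLeft {p : Player} {D B : Finset V} (hBD : ∀ b ∈ B, b ∉ D)
    (hB : ∀ v, ∀ b ∈ B, ∀ b' ∈ B, b ∈ closedNbhd G v → b' ∈ closedNbhd G v → b = b') :
    B.card ≤ movesLeft G p D := by
  classical
  induction hn : B.card generalizing p D B with
  | zero => exact Nat.zero_le _
  | succ n ih =>
    have key : ∀ (q : Player) (v : V), n ≤ movesLeft G q (play G D v) := by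
      intro q v
      -- The move `v` dominates at most one vertex of `B`; if it dominates none, `B` is trimmed to
      -- size `n`.
      obtain ⟨A, hAB, hA, hAv⟩ : ∃ A ⊆ B, A.card = n ∧ ∀ b ∈ A, b ∉ closedNbhd G v := by
        by_cases h : ∃ b ∈ B, b ∈ closedNbhd G v
        · obtain ⟨b, hb, hbv⟩ := h
          refine ⟨B.erase b, Finset.erase_subset _ _, ?_, fun b' hb' hb'v => ?_⟩
          · rw [Finset.card_erase_of_mem hb, hn, Nat.add_sub_cancel]
          · rw [Finset.mem_erase] at hb'
            exact hb'.1 (hB v b' hb'.2 b hb hb'v hbv)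
        · push Not at h
          obtain ⟨A, hAB, hA⟩ := Finset.exists_subset_card_eq (s := B) (n := n) (by omega)
          exact ⟨A, hAB, hA, fun b hb => h b (hAB hb)⟩
      refine ih (B := A) (fun b hb => ?_)
        (fun v b hb b' hb' => hB v b (hAB hb) b' (hAB hb')) hA
      rw [mem_play, not_or]
      exact ⟨hBD b (hAB hb), hAv b hb⟩
    obtain ⟨b, hb⟩ : B.Nonempty := Finset.card_pos.1 (by omega)
    have hbl : b ∈ legalMoves G D := mem_legalMoves_self (hBD b hb)
    cases p with
    | staller => exact le_movesLeft_staller hbl (key _ b)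
    | dominator => exact le_movesLeft_dominator ⟨b, hbl⟩ fun v _ => key _ v

/-- The bound obtained when Dominator answers the first move with `x`. -/
theorem movesLeft_staller_empty_le {n : ℕ} (x : V)
    (hS : ∀ D, closedNbhd G x ⊆ D → movesLeft G Player.staller D ≤ n)
    (hD : ∀ D, closedNbhd G x ⊆ D → movesLeft G Player.dominator D ≤ n + 1) :
    stallerGameDominationNumber G ≤ n + 2 := by
  refine movesLeft_staller_le fun v _ => ?_
  by_cases hx : x ∈ legalMoves G (play G ∅ v)
  · exact movesLeft_dominator_le hx (hS _ (closedNbhd_subset_play _ _))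
  -- If `x` is illegal, its closed neighbourhood is already dominated, and it is still Dominator's
  -- turn: hence the weaker bound `n + 1` in `hD`.
  · refine hD _ fun w hw => by_contra fun hwD => hx (mem_legalMoves.2 ⟨w, hw, hwD⟩)

/-! ### Values below four. -/

/-- Adding an edge to a graph on which two moves suffice leaves two moves sufficient. -/
theorem stallerGameDominationNumber_le_two_of_le {G G' : SimpleGraph V} (hGG' : G ≤ G')
    (h : stallerGameDominationNumber G ≤ 2) : stallerGameDominationNumber G' ≤ 2 := by
  have hsub : ∀ v, closedNbhd G v ⊆ closedNbhd G' v := fun v w hw =>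
    mem_closedNbhd.2 ((mem_closedNbhd.1 hw).imp_right fun h => hGG' h)
  refine movesLeft_staller_le fun v _ => ?_
  have hvG : v ∈ legalMoves G ∅ := mem_legalMoves_self (by simp)
  have h1 : movesLeft G Player.dominator (play G ∅ v) ≤ 1 := by
    by_contra hc
    have := le_movesLeft_staller hvG (n := 2) (by omega)
    rw [stallerGameDominationNumber] at h
    omega
  by_cases hall : ∀ w, w ∈ play G' ∅ v
  · rw [movesLeft_eq_zero hall]
    exact Nat.zero_le _
  push Not at hall
  obtain ⟨u, hu⟩ := hall
  have huG : u ∉ play G ∅ v := fun hc => hu (by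
    rw [mem_play] at hc ⊢
    exact hc.imp_right fun h => hsub v h)
  -- Only one move is left to Dominator in `G`, so some `w` dominates everything that remains.
  obtain ⟨w, hw⟩ : ∃ w, ∀ z, z ∈ play G (play G ∅ v) w := by
    by_contra! hc
    have := le_movesLeft_dominator (G := G) (n := 1) ⟨u, mem_legalMoves_self huG⟩ fun w _ => by
      obtain ⟨z, hz⟩ := hc w
      exact le_movesLeft_staller (mem_legalMoves_self hz) (Nat.zero_le _)
    omega
  have hcover : ∀ z, z ∈ play G' (play G' ∅ v) w := by
    intro z
    have := hw z
    simp only [mem_play] at this ⊢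
    exact this.imp (Or.imp_right fun h => hsub v h) fun h => hsub w h
  refine movesLeft_dominator_le (v := w) (mem_legalMoves.2 ⟨u, ?_, hu⟩)
    (movesLeft_eq_zero hcover).le
  exact (mem_play.1 (hcover u)).resolve_left hu

theorem two_le_stallerGameDominationNumber {u v : V} (huv : u ≠ v) (h : ¬ G.Adj u v) :
    2 ≤ stallerGameDominationNumber G := by
  refine le_movesLeft_staller (v := u) (mem_legalMoves_self (by simp))
    (le_movesLeft_dominator (n := 0) ⟨v, mem_legalMoves_self ?_⟩ fun _ _ => Nat.zero_le _)
  simp [mem_play, mem_closedNbhd, huv.symm, h]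

/-- Removing an edge never lowers a value of at most three. -/
theorem stallerGameDominationNumber_deleteEdges_ne {ℓ : ℕ} (hℓ : ℓ < 4) {G : SimpleGraph V}
    {e : Sym2 V} (he : e ∈ G.edgeSet) (hG : stallerGameDominationNumber G = ℓ) :
    (stallerGameDominationNumber (G.deleteEdges {e}) : ℤ) ≠ (ℓ : ℤ) - 1 := by
  intro h
  induction e with | h u v => ?_
  have huv : u ≠ v := G.ne_of_adj he
  have h2 : 2 ≤ stallerGameDominationNumber (G.deleteEdges {s(u, v)}) :=
    two_le_stallerGameDominationNumber huv (by simp)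
  have := stallerGameDominationNumber_le_two_of_le (G.deleteEdges_le {s(u, v)}) (by omega)
  omega

/-! ### Staller's strategies that tolerate passes. -/

/-- `Forces N n C`: in the game on a graph with closed neighbourhoods `N` and with `C` the set of
undominated vertices, Staller, who is to move, can force `n` more moves even if Dominator is
allowed to pass. -/
def Forces {c : ℕ} (N : Fin c → Finset (Fin c)) : ℕ → Finset (Fin c) → Bool
  | 0, _ => true
  | 1, C => decide C.Nonempty
  | n + 2, C => decide (∃ v, (C ∩ N v).Nonempty ∧ Forces N (n + 1) (C \ N v) = true ∧
      ∀ w, Forces N n ((C \ N v) \ N w) = true)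

theorem Forces.nonempty {c : ℕ} {N : Fin c → Finset (Fin c)} {n : ℕ} {C : Finset (Fin c)}
    (h : Forces N (n + 1) C = true) : C.Nonempty := by
  cases n with
  | zero => simpa [Forces] using h
  | succ n =>
    rw [Forces, decide_eq_true_iff] at h
    obtain ⟨v, hv, -⟩ := h
    exact hv.mono Finset.inter_subset_left

/-- If `G` consists of a core with closed neighbourhoods `N` and of a remainder that does not
interact with the part `C` of the core, then the moves that Staller forces on `C` add to the moves
needed for a set `B` of vertices no two of which can be dominated by the same move. -/
theorem le_movesLeft_of_forces {c : ℕ} {N : Fin c → Finset (Fin c)} {core : Fin c → V}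
    (hN : ∀ i j, core j ∈ closedNbhd G (core i) ↔ j ∈ N i) {n : ℕ} {C : Finset (Fin c)}
    {D B : Finset V}
    (hcoreB : ∀ i, ∀ b ∈ B, b ∉ closedNbhd G (core i))
    (hout : ∀ v, v ∉ Set.range core → ∀ i ∈ C, core i ∉ closedNbhd G v)
    (hB : ∀ v, ∀ b ∈ B, ∀ b' ∈ B, b ∈ closedNbhd G v → b' ∈ closedNbhd G v → b = b')
    (hCD : ∀ i ∈ C, core i ∉ D) (hBD : ∀ b ∈ B, b ∉ D) (hF : Forces N n C = true) :
    n + B.card ≤ movesLeft G Player.staller D := by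
  classical
  have coreC : ∀ {i : Fin c} {C : Finset (Fin c)} {D : Finset V}, (∀ i ∈ C, core i ∉ D) →
      ∀ j ∈ C \ N i, core j ∉ play G D (core i) := fun hCD j hj => by
    rw [Finset.mem_sdiff] at hj
    rw [mem_play, not_or, hN]
    exact ⟨hCD j hj.1, hj.2⟩
  have coreB : ∀ {i : Fin c} {D : Finset V}, (∀ b ∈ B, b ∉ D) → ∀ b ∈ B,
      b ∉ play G D (core i) := fun {i} {D} hBD b hb => by
    rw [mem_play, not_or]
    exact ⟨hBD b hb, hcoreB i b hb⟩
  induction n using Nat.strong_induction_on generalizing C D B with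
  | _ n ih =>
  match n, hF with
  | 0, _ => simpa using card_le_movesLeft hBD hB
  | 1, hF =>
    obtain ⟨i, hi⟩ := Forces.nonempty hF
    rw [add_comm]
    exact le_movesLeft_staller (mem_legalMoves_self (hCD i hi)) (card_le_movesLeft (coreB hBD) hB)
  | n + 2, hF =>
    rw [Forces, decide_eq_true_iff] at hF
    obtain ⟨i, ⟨j, hj⟩, hpass, hmove⟩ := hF
    rw [Finset.mem_inter] at hj
    have hCD' := coreC (i := i) hCD
    have hBD' := coreB (i := i) hBD
    have : n + B.card + 1 ≤ movesLeft G Player.dominator (play G D (core i)) := by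
      obtain ⟨j', hj'⟩ := Forces.nonempty hpass
      refine le_movesLeft_dominator ⟨_, mem_legalMoves_self (hCD' j' hj')⟩ fun v _ => ?_
      -- A reply in the core leaves `B` intact and is covered by `hmove`. A reply outside acts as a
      -- pass on `C` and uses up at most one vertex of `B`, so the induction hypothesis at `n + 1`
      -- makes up for the loss.
      by_cases hv : v ∈ Set.range core
      · obtain ⟨i', rfl⟩ := hv
        exact ih n (by omega) hcoreB
          (fun v hv k hk => hout v hv k (Finset.sdiff_subset (Finset.sdiff_subset hk))) hB
          (coreC hCD') (coreB hBD') (hmove i') coreB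
      · have hcard : B.card ≤ (B.filter fun b => b ∉ closedNbhd G v).card + 1 := by
          rw [← Finset.card_filter_add_card_filter_not (s := B) (fun b => b ∉ closedNbhd G v)]
          refine Nat.add_le_add_left (Finset.card_le_one.2 fun a ha b hb => ?_) _
          simp only [Finset.mem_filter, not_not] at ha hb
          exact hB v a ha.1 b hb.1 ha.2 hb.2
        have := ih (n + 1) (by omega) (C := C \ N i) (D := play G (play G D (core i)) v)
          (B := B.filter fun b => b ∉ closedNbhd G v)
          (fun i b hb => hcoreB i b (Finset.filter_subset _ _ hb))
          (fun v hv k hk => hout v hv k (Finset.sdiff_subset hk))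
          (fun v b hb b' hb' => hB v b (Finset.filter_subset _ _ hb) b'
            (Finset.filter_subset _ _ hb'))
          (fun k hk => by
            rw [mem_play, not_or]
            exact ⟨hCD' k hk, hout v hv k (Finset.sdiff_subset hk)⟩)
          (fun b hb => by
            rw [Finset.mem_filter] at hb
            rw [mem_play, not_or]
            exact ⟨hBD' b hb.1, hb.2⟩) hpass
          (fun {i D} hBD b hb => by
            rw [mem_play, not_or]
            exact ⟨hBD b hb, hcoreB i b (Finset.filter_subset _ _ hb)⟩)
        omega
    have := le_movesLeft_staller (mem_legalMoves.2 ⟨_, (hN i j).2 hj.2, hCD j hj.1⟩) this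
    omega

end Game

/-! ### The graph `H`, with value four. -/

section GraphH

/-- The closed neighbourhoods of `graphH`. -/
def nbhdH : Fin 8 → Finset (Fin 8) :=
  ![{0, 1, 2, 3, 4, 5}, {0, 1, 6}, {0, 2}, {0, 3}, {0, 4}, {0, 5, 6, 7}, {1, 5, 6, 7}, {5, 6, 7}]

/-- The closed neighbourhoods of `graphH` without the edge `edgeH`. -/
def nbhdHDel : Fin 8 → Finset (Fin 8) :=
  ![{0, 1, 2, 3, 4, 5}, {0, 1}, {0, 2}, {0, 3}, {0, 4}, {0, 5, 6, 7}, {5, 6, 7}, {5, 6, 7}]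

theorem mem_closedNbhd_graphH (i j : Fin 8) : j ∈ closedNbhd graphH i ↔ j ∈ nbhdH i := by
  simp only [mem_closedNbhd, graphH, SimpleGraph.fromEdgeSet_adj, Set.mem_insert_iff,
    Set.mem_singleton_iff]
  revert i j
  decide

theorem mem_closedNbhd_graphH_deleteEdges (i j : Fin 8) :
    j ∈ closedNbhd (graphH.deleteEdges {edgeH}) i ↔ j ∈ nbhdHDel i := by
  simp only [mem_closedNbhd, graphH, edgeH, SimpleGraph.deleteEdges_adj,
    SimpleGraph.fromEdgeSet_adj, Set.mem_insert_iff, Set.mem_singleton_iff]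
  revert i j
  decide

theorem graphH_connected : graphH.Connected := by
  have adj : ∀ i j : Fin 8, j ≠ i → j ∈ nbhdH i → graphH.Reachable i j := fun i j hij h =>
    (((mem_closedNbhd.1 ((mem_closedNbhd_graphH i j).2 h)).resolve_left hij)).reachable
  have h05 := adj 0 5 (by decide) (by decide)
  refine SimpleGraph.connected_iff_exists_forall_reachable _ |>.2 ⟨0, fun v => ?_⟩
  by_cases hv : v ∈ nbhdH 0
  · by_cases h0 : v = 0
    · rw [h0]
    · exact adj 0 v h0 hv
  · have : ∀ v ∉ nbhdH 0, v ≠ 5 ∧ v ∈ nbhdH 5 := by decide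
    exact h05.trans (adj 5 v (this v hv).1 (this v hv).2)

theorem edgeH_mem : edgeH ∈ graphH.edgeSet := by
  simp [edgeH, graphH]

theorem stallerGameDominationNumber_graphH : stallerGameDominationNumber graphH = 4 := by
  have hU : ∀ D, closedNbhd graphH 0 ⊆ D → ∀ v, v ∉ D → v ∈ ({6, 7} : Finset (Fin 8)) := by
    intro D hD v hv
    have h1 := mt (fun h => hD ((mem_closedNbhd_graphH 0 v).2 h)) hv
    clear hv
    revert v
    decide
  refine le_antisymm (movesLeft_staller_empty_le 0 (fun D hD => movesLeft_le_card (hU D hD))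
    fun D hD => (movesLeft_le_card (hU D hD)).trans (by decide)) ?_
  exact le_movesLeft_of_forces (core := id) (N := nbhdH) (n := 4) (C := Finset.univ) (B := ∅)
    mem_closedNbhd_graphH (by simp) (by simp) (by simp) (by simp) (by simp) (by decide +kernel)

/-- Without the edge, `6` and `7` have the same closed neighbourhood, and no move separates them.
With it, the leaf `1` dominates `6` but not `7`. -/
theorem stallerGameDominationNumber_graphH_deleteEdges :
    stallerGameDominationNumber (graphH.deleteEdges {edgeH}) = 3 := by
  have hU : ∀ D, closedNbhd (graphH.deleteEdges {edgeH}) 0 ⊆ D → ∀ v, v ∉ D →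
      v ∈ ({6, 7} : Finset (Fin 8)) := by
    intro D hD v hv
    have h1 := mt (fun h => hD ((mem_closedNbhd_graphH_deleteEdges 0 v).2 h)) hv
    clear hv
    revert v
    decide
  refine le_antisymm (movesLeft_staller_empty_le 0
    (fun D hD => movesLeft_staller_le fun v hv => ?_)
    fun D hD => movesLeft_le_card (hU D hD)) ?_
  · obtain ⟨w, hwv, hwD⟩ := mem_legalMoves.1 hv
    have hw := hU D hD w hwD
    rw [mem_closedNbhd_graphH_deleteEdges] at hwv
    refine (movesLeft_eq_zero fun z => ?_).le
    rw [mem_play]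
    by_contra! hz
    have hz' := hU D hD z hz.1
    rw [mem_closedNbhd_graphH_deleteEdges] at hz
    have : ∀ v w z : Fin 8, w ∈ nbhdHDel v → w ∈ ({6, 7} : Finset (Fin 8)) →
        z ∈ ({6, 7} : Finset (Fin 8)) → z ∈ nbhdHDel v := by decide
    exact hz.2 (this v w z hwv hw hz')
  · exact le_movesLeft_of_forces (core := id) (N := nbhdHDel) (n := 3) (C := Finset.univ) (B := ∅)
      mem_closedNbhd_graphH_deleteEdges (by simp) (by simp) (by simp) (by simp) (by simp)
      (by decide +kernel)

end GraphH

/-! ### The graphs `Y_k`, with value `k + 5`. -/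

section GraphY

/-- The closed neighbourhoods of `Y_0`. -/
def nbhdY : Fin 9 → Finset (Fin 9) :=
  ![{0, 1, 4, 5, 6, 7}, {0, 1, 2, 8}, {1, 2, 3, 5}, {2, 3, 4}, {0, 3, 4}, {0, 2, 5}, {0, 6},
    {0, 7}, {1, 8}]

/-- The closed neighbourhoods of `Y_0 - e`. -/
def nbhdYDel : Fin 9 → Finset (Fin 9) :=
  ![{0, 1, 4, 5, 6, 7}, {0, 1, 2, 8}, {1, 2, 3}, {2, 3, 4}, {0, 3, 4}, {0, 5}, {0, 6},
    {0, 7}, {1, 8}]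

variable {k : ℕ}

theorem graphY_adj_inl_inl {i j : Fin 9} :
    (graphY k).Adj (Sum.inl i) (Sum.inl j) ↔ s(i, j) ∈ edgesY0 ∧ i ≠ j := by
  have : s((Sum.inl i : YVertex k), Sum.inl j) = Sym2.map Sum.inl s(i, j) := rfl
  simp only [graphY, SimpleGraph.fromEdgeSet_adj, Set.mem_union, this,
    (Sym2.map.injective Sum.inl_injective).mem_set_image]
  simp

theorem graphY_adj_inl_inr {i : Fin 9} {a : Fin k} {b : Fin 2} :
    (graphY k).Adj (Sum.inl i) (Sum.inr (a, b)) ↔ i = 0 ∧ b = 0 := by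
  have : s((Sum.inl i : YVertex k), Sum.inr (a, b)) ∉ Sym2.map Sum.inl '' edgesY0 := by
    rintro ⟨z, -, hz⟩
    induction z with | h u v => ?_
    simp at hz
  simp only [graphY, SimpleGraph.fromEdgeSet_adj, Set.mem_union, this]
  simp [eq_comm]

theorem graphY_adj_inr_inr {a a' : Fin k} {b b' : Fin 2} :
    (graphY k).Adj (Sum.inr (a, b)) (Sum.inr (a', b')) ↔ a = a' ∧ b ≠ b' := by
  have : s((Sum.inr (a, b) : YVertex k), Sum.inr (a', b')) ∉ Sym2.map Sum.inl '' edgesY0 := by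
    rintro ⟨z, -, hz⟩
    induction z with | h u v => ?_
    simp at hz
  simp only [graphY, SimpleGraph.fromEdgeSet_adj, Set.mem_union, this]
  fin_cases b <;> fin_cases b' <;> simp [eq_comm]

theorem mem_closedNbhd_graphY (i j : Fin 9) :
    (Sum.inl j : YVertex k) ∈ closedNbhd (graphY k) (Sum.inl i) ↔ j ∈ nbhdY i := by
  simp only [mem_closedNbhd, graphY_adj_inl_inl, Sum.inl.injEq, edgesY0, Set.mem_insert_iff,
    Set.mem_singleton_iff]
  revert i j
  decide

theorem mem_closedNbhd_graphY_deleteEdges (i j : Fin 9) :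
    (Sum.inl j : YVertex k) ∈ closedNbhd ((graphY k).deleteEdges {edgeY k}) (Sum.inl i) ↔
      j ∈ nbhdYDel i := by
  have : s((Sum.inl i : YVertex k), Sum.inl j) = edgeY k ↔ s(i, j) = s(2, 5) := by
    simp [edgeY]
  simp only [mem_closedNbhd, SimpleGraph.deleteEdges_adj, graphY_adj_inl_inl, Sum.inl.injEq,
    edgesY0, Set.mem_insert_iff, Set.mem_singleton_iff, this]
  clear this
  revert i j
  decide

theorem graphY_connected (k : ℕ) : (graphY k).Connected := by
  have adj : ∀ i j : Fin 9, j ≠ i → j ∈ nbhdY i →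
      (graphY k).Reachable (Sum.inl i) (Sum.inl j) := fun i j hij h =>
    ((mem_closedNbhd.1 ((mem_closedNbhd_graphY i j).2 h)).resolve_left
      (fun hc => hij (Sum.inl_injective hc))).reachable
  have h1 := adj 0 1 (by decide) (by decide)
  have h4 := adj 0 4 (by decide) (by decide)
  refine SimpleGraph.connected_iff_exists_forall_reachable _ |>.2 ⟨Sum.inl 0, ?_⟩
  rintro (v | ⟨a, b⟩)
  · by_cases h0 : v = 0
    · rw [h0]
    have : ∀ v : Fin 9, v ≠ 0 →
        v ∈ nbhdY 0 ∨ (v ≠ 1 ∧ v ∈ nbhdY 1) ∨ (v ≠ 4 ∧ v ∈ nbhdY 4) := by decide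
    rcases this v h0 with h | h | h
    · exact adj 0 v h0 h
    · exact h1.trans (adj 1 v h.1 h.2)
    · exact h4.trans (adj 4 v h.1 h.2)
  · have ha : (graphY k).Reachable (Sum.inl 0) (Sum.inr (a, 0)) :=
      (graphY_adj_inl_inr.2 ⟨rfl, rfl⟩).reachable
    by_cases hb : b = 0
    · rw [hb]; exact ha
    · exact ha.trans (graphY_adj_inr_inr.2 ⟨rfl, Ne.symm hb⟩).reachable

theorem edgeY_mem (k : ℕ) : edgeY k ∈ (graphY k).edgeSet := by
  rw [edgeY, SimpleGraph.mem_edgeSet, graphY_adj_inl_inl]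
  simp [edgesY0]

/-- The far ends of the attached paths. -/
def pathEnds (k : ℕ) : Finset (YVertex k) := Finset.univ.image fun a => Sum.inr (a, 1)

theorem card_pathEnds (k : ℕ) : (pathEnds k).card = k := by
  rw [pathEnds, Finset.card_image_of_injective _ (fun a b h => by simpa using h), Finset.card_univ,
    Fintype.card_fin]

/-- The vertices that `x` does not dominate. -/
def restY (k : ℕ) : Finset (YVertex k) := {Sum.inl 2, Sum.inl 3, Sum.inl 8} ∪ pathEnds k

theorem card_restY_le (k : ℕ) : (restY k).card ≤ k + 3 := by
  refine (Finset.card_union_le _ _).trans ?_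
  rw [card_pathEnds, add_comm]
  exact Nat.add_le_add_left Finset.card_le_three _

/-- The core is `Y_0` and `B` consists of the far path ends. The vertex `x = 0` is left out of `C`
because it is the only core vertex that a path vertex can dominate. -/
theorem le_movesLeft_Y {G : SimpleGraph (YVertex k)} (hG : G ≤ graphY k)
    {N : Fin 9 → Finset (Fin 9)}
    (hN : ∀ i j, (Sum.inl j : YVertex k) ∈ closedNbhd G (Sum.inl i) ↔ j ∈ N i) {n : ℕ}
    (hF : Forces N n (Finset.univ.erase 0) = true) :
    n + k ≤ stallerGameDominationNumber G := by
  conv_lhs => rw [← card_pathEnds k]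
  have hend : ∀ b ∈ pathEnds k, ∃ a, b = Sum.inr (a, 1) := fun b hb => by
    simpa [pathEnds, eq_comm] using hb
  refine le_movesLeft_of_forces hN (fun i b hb h => ?_) ?_ ?_ (by simp) (by simp) hF
  · obtain ⟨a, rfl⟩ := hend b hb
    rcases mem_closedNbhd.1 h with h | h
    · simp at h
    · simpa using graphY_adj_inl_inr.1 (hG h)
  · rintro (v | ⟨a, b⟩) hv i hi h
    · exact hv ⟨v, rfl⟩
    · rcases mem_closedNbhd.1 h with h | h
      · simp at h
      · exact Finset.ne_of_mem_erase hi (graphY_adj_inl_inr.1 (hG h).symm).1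
  · intro v b hb b' hb' h h'
    obtain ⟨a, rfl⟩ := hend b hb
    obtain ⟨a', rfl⟩ := hend b' hb'
    have key : ∀ a, (Sum.inr (a, 1) : YVertex k) ∈ closedNbhd G v → ∃ b, v = Sum.inr (a, b) := by
      intro a ha
      rcases mem_closedNbhd.1 ha with rfl | ha
      · exact ⟨1, rfl⟩
      rcases v with v | ⟨c, d⟩
      · simpa using graphY_adj_inl_inr.1 (hG ha)
      · exact ⟨d, by rw [(graphY_adj_inr_inr.1 (hG ha)).1]⟩
    obtain ⟨c, rfl⟩ := key a h
    obtain ⟨c', hc⟩ := key a' h'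
    simp only [Sum.inr.injEq, Prod.mk.injEq] at hc
    rw [hc.1]

theorem mem_restY {G : SimpleGraph (YVertex k)} {D : Finset (YVertex k)}
    (hG : ∀ v, v ∈ closedNbhd (graphY k) (Sum.inl 0) → v ∈ closedNbhd G (Sum.inl 0))
    (hD : closedNbhd G (Sum.inl 0) ⊆ D) {v : YVertex k} (hv : v ∉ D) : v ∈ restY k := by
  have h := mt (fun h => hD (hG v h)) hv
  rcases v with v | ⟨a, b⟩
  · rw [mem_closedNbhd_graphY] at h
    have : ∀ v ∉ nbhdY 0, v = 2 ∨ v = 3 ∨ v = 8 := by decide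
    rcases this v h with rfl | rfl | rfl <;> simp [restY]
  · rw [mem_closedNbhd, graphY_adj_inl_inr] at h
    have : b = 1 := by simp at h; omega
    simp [restY, pathEnds, this]

theorem stallerGameDominationNumber_graphY (k : ℕ) :
    stallerGameDominationNumber (graphY k) = k + 5 := by
  have hU : ∀ (p : Player) (D : Finset (YVertex k)), closedNbhd (graphY k) (Sum.inl 0) ⊆ D →
      movesLeft (graphY k) p D ≤ k + 3 := fun p D hD =>
    (movesLeft_le_card fun v hv => mem_restY (fun _ h => h) hD hv).trans (card_restY_le k)
  refine le_antisymm (movesLeft_staller_empty_le (Sum.inl 0) (hU _) fun D hD =>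
    (hU _ D hD).trans (Nat.le_succ _)) ?_
  rw [add_comm]
  exact le_movesLeft_Y le_rfl mem_closedNbhd_graphY (by decide +kernel)

/-- At most `k + 3` vertices remain, and one move has to be saved. Either two of them are dominated
once Staller has moved (`two`), or Dominator's reply dominates two more at once (`reply`): `x'`
takes `2` and `3`, `t` takes `2` and `8`. The danger is that Staller dominates `2` alone, since `3`
and `8` have no common dominator. -/
theorem movesLeft_staller_graphY_deleteEdges_le {D : Finset (YVertex k)}
    (hD : closedNbhd ((graphY k).deleteEdges {edgeY k}) (Sum.inl 0) ⊆ D) :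
    movesLeft ((graphY k).deleteEdges {edgeY k}) Player.staller D ≤ k + 2 := by
  classical
  set G := (graphY k).deleteEdges {edgeY k} with hGdef
  have hN := mem_closedNbhd_graphY_deleteEdges (k := k)
  rw [← hGdef] at hN
  have hG : ∀ v, v ∈ closedNbhd (graphY k) (Sum.inl 0) → v ∈ closedNbhd G (Sum.inl 0) := by
    intro v hv
    rw [mem_closedNbhd] at hv ⊢
    refine hv.imp_right fun h => ?_
    rw [hGdef, SimpleGraph.deleteEdges_adj]
    exact ⟨h, by simp [edgeY]⟩
  have hU : ∀ v, v ∉ D → v ∈ restY k := fun v hv => mem_restY hG hD hv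
  have hcard := card_restY_le k
  refine movesLeft_staller_le fun v hv => ?_
  have two : ∀ a b, a ≠ b → a ∈ restY k → b ∈ restY k → a ∈ play G D v → b ∈ play G D v →
      movesLeft G Player.dominator (play G D v) ≤ k + 1 := by
    intro a b hab ha hb haD hbD
    refine (movesLeft_le_card (U := ((restY k).erase a).erase b) fun w hw => ?_).trans ?_
    · rw [Finset.mem_erase, Finset.mem_erase]
      exact ⟨fun h => hw (h ▸ hbD), fun h => hw (h ▸ haD),
        hU w fun h => hw (subset_play _ _ h)⟩
    · rw [Finset.card_erase_of_mem (Finset.mem_erase.2 ⟨hab.symm, hb⟩),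
        Finset.card_erase_of_mem ha]
      omega
  have reply : ∀ x a b, a ≠ b → a ∈ restY k → b ∈ restY k → a ∉ play G D v → b ∉ play G D v →
      a ∈ closedNbhd G x → b ∈ closedNbhd G x →
      movesLeft G Player.dominator (play G D v) ≤ k + 1 := by
    intro x a b hab ha hb haD hbD hax hbx
    obtain ⟨c, hcv, hcD⟩ := mem_legalMoves.1 hv
    have hcD' : c ∈ play G D v := closedNbhd_subset_play _ _ hcv
    have hca : c ≠ a := fun h => haD (h ▸ hcD')
    have hcb : c ≠ b := fun h => hbD (h ▸ hcD')
    refine movesLeft_dominator_le (v := x) (mem_legalMoves.2 ⟨a, hax, haD⟩)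
      ((movesLeft_le_card (U := (((restY k).erase a).erase b).erase c) fun w hw => ?_).trans ?_)
    · rw [mem_play, not_or] at hw
      rw [Finset.mem_erase, Finset.mem_erase, Finset.mem_erase]
      exact ⟨fun h => hw.1 (h ▸ hcD'), fun h => hw.2 (h ▸ hbx), fun h => hw.2 (h ▸ hax),
        hU w fun h => hw.1 (subset_play _ _ h)⟩
    · rw [Finset.card_erase_of_mem (Finset.mem_erase.2 ⟨hcb, Finset.mem_erase.2 ⟨hca, hU c hcD⟩⟩),
        Finset.card_erase_of_mem (Finset.mem_erase.2 ⟨hab.symm, hb⟩),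
        Finset.card_erase_of_mem ha]
      omega
  have m2 : (Sum.inl 2 : YVertex k) ∈ restY k := by simp [restY]
  have m3 : (Sum.inl 3 : YVertex k) ∈ restY k := by simp [restY]
  have m8 : (Sum.inl 8 : YVertex k) ∈ restY k := by simp [restY]
  have n23 : (Sum.inl 2 : YVertex k) ≠ Sum.inl 3 := by simp
  have n28 : (Sum.inl 2 : YVertex k) ≠ Sum.inl 8 := by simp
  have n38 : (Sum.inl 3 : YVertex k) ≠ Sum.inl 8 := by simp
  by_cases h2 : (Sum.inl 2 : YVertex k) ∈ play G D v
  · by_cases h3 : (Sum.inl 3 : YVertex k) ∈ play G D v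
    · exact two _ _ n23 m2 m3 h2 h3
    by_cases h8 : (Sum.inl 8 : YVertex k) ∈ play G D v
    · exact two _ _ n28 m2 m8 h2 h8
    by_cases h2D : (Sum.inl 2 : YVertex k) ∈ D
    · obtain ⟨c, hcv, hcD⟩ := mem_legalMoves.1 hv
      exact two _ c (fun h => hcD (h ▸ h2D)) m2 (hU c hcD) h2 (closedNbhd_subset_play _ _ hcv)
    · have h2v := (mem_play.1 h2).resolve_left h2D
      rcases v with v | ⟨a, b⟩
      -- This is where the deletion of `e` matters: in `Y_k` the vertex `y` dominates `2` but
      -- neither `3` nor `8`.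
      · have : ∀ v, 2 ∈ nbhdYDel v → 3 ∈ nbhdYDel v ∨ 8 ∈ nbhdYDel v := by decide
        rcases this v ((hN _ _).1 h2v) with h | h
        · exact absurd (closedNbhd_subset_play _ _ ((hN _ _).2 h)) h3
        · exact absurd (closedNbhd_subset_play _ _ ((hN _ _).2 h)) h8
      · rcases mem_closedNbhd.1 h2v with h | h
        · simp at h
        · simpa using graphY_adj_inl_inr.1 ((graphY k).deleteEdges_le _ h).symm
  · by_cases h3 : (Sum.inl 3 : YVertex k) ∈ play G D v
    · by_cases h8 : (Sum.inl 8 : YVertex k) ∈ play G D v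
      · exact two _ _ n38 m3 m8 h3 h8
      · exact reply (Sum.inl 1) _ _ n28 m2 m8 h2 h8 ((hN _ _).2 (by decide))
          ((hN _ _).2 (by decide))
    · exact reply (Sum.inl 2) _ _ n23 m2 m3 h2 h3 ((hN _ _).2 (by decide))
        ((hN _ _).2 (by decide))

theorem stallerGameDominationNumber_graphY_deleteEdges (k : ℕ) :
    stallerGameDominationNumber ((graphY k).deleteEdges {edgeY k}) = k + 4 := by
  refine le_antisymm (movesLeft_staller_empty_le (Sum.inl 0)
    (fun D hD => movesLeft_staller_graphY_deleteEdges_le hD) fun D hD =>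
      (movesLeft_le_card fun v hv => mem_restY (fun v hv => ?_) hD hv).trans (card_restY_le k)) ?_
  · rw [mem_closedNbhd] at hv ⊢
    refine hv.imp_right fun h => ?_
    rw [SimpleGraph.deleteEdges_adj]
    exact ⟨h, by simp [edgeY]⟩
  · rw [add_comm]
    exact le_movesLeft_Y (SimpleGraph.deleteEdges_le _) mem_closedNbhd_graphY_deleteEdges
      (by decide +kernel)

end GraphY

end DominationGame

theorem mainTheorem8 :
    -- for every `ℓ ≥ 4` there is a (connected) graph `G` with an edge `e` as required
    (∀ ℓ : ℕ, 4 ≤ ℓ →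
      ∃ (V : Type) (_ : Fintype V) (G : SimpleGraph V) (e : Sym2 V),
        G.Connected ∧ e ∈ G.edgeSet ∧
        DominationGame.stallerGameDominationNumber G = ℓ ∧
        DominationGame.stallerGameDominationNumber (G.deleteEdges {e}) = ℓ - 1) ∧
    -- the witnesses `Y_k`, for `ℓ = k + 5`
    (∀ k : ℕ,
      (DominationGame.graphY k).Connected ∧
      DominationGame.edgeY k ∈ (DominationGame.graphY k).edgeSet ∧
      DominationGame.stallerGameDominationNumber (DominationGame.graphY k) = k + 5 ∧
      DominationGame.stallerGameDominationNumber
        ((DominationGame.graphY k).deleteEdges {DominationGame.edgeY k}) = k + 4) ∧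
    -- the witness `H`, for `ℓ = 4`
    (DominationGame.graphH.Connected ∧
      DominationGame.edgeH ∈ DominationGame.graphH.edgeSet ∧
      DominationGame.stallerGameDominationNumber DominationGame.graphH = 4 ∧
      DominationGame.stallerGameDominationNumber
        (DominationGame.graphH.deleteEdges {DominationGame.edgeH}) = 3) ∧
    -- there are no such graphs for `ℓ < 4`
    (∀ ℓ : ℕ, ℓ < 4 →
      ∀ (V : Type*) [Fintype V] (G : SimpleGraph V) (e : Sym2 V), e ∈ G.edgeSet →
        ¬ (DominationGame.stallerGameDominationNumber G = ℓ ∧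
            (DominationGame.stallerGameDominationNumber (G.deleteEdges {e}) : ℤ) = (ℓ : ℤ) - 1)) := by
  refine ⟨fun ℓ hℓ => ?_, fun k => ⟨DominationGame.graphY_connected k, DominationGame.edgeY_mem k,
    DominationGame.stallerGameDominationNumber_graphY k,
      DominationGame.stallerGameDominationNumber_graphY_deleteEdges k⟩,
    ⟨DominationGame.graphH_connected, DominationGame.edgeH_mem,
      DominationGame.stallerGameDominationNumber_graphH,
      DominationGame.stallerGameDominationNumber_graphH_deleteEdges⟩,
    fun ℓ hℓ V _ G e he h => DominationGame.stallerGameDominationNumber_deleteEdges_ne hℓ he h.1 h.2⟩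
  -- The graphs `Y_k` start at value 5, so `H` supplies the case `ℓ = 4`.
  rcases hℓ.eq_or_lt with rfl | hℓ
  · exact ⟨_, inferInstance, DominationGame.graphH, DominationGame.edgeH,
      DominationGame.graphH_connected, DominationGame.edgeH_mem,
      DominationGame.stallerGameDominationNumber_graphH,
      DominationGame.stallerGameDominationNumber_graphH_deleteEdges⟩
  · obtain ⟨k, rfl⟩ := Nat.exists_eq_add_of_le' hℓ
    exact ⟨_, inferInstance, DominationGame.graphY k, DominationGame.edgeY k,
      DominationGame.graphY_connected k, DominationGame.edgeY_mem k,
      DominationGame.stallerGameDominationNumber_graphY k,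
      DominationGame.stallerGameDominationNumber_graphY_deleteEdges k⟩
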